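/- Let $\mathcal V$ be a variety of algebras, i.e. the category of models in $\mathbf{Set}$ (finite-product-preserving functors $T\to\mathbf{Set}$) of a small Lawvere theory $T$: a category with finite products in which every object is isomorphic to a finite power of a distinguished object $x$. Write $|A|=A(x)$ for the underlying set of $A\in\mathcal V$ and $F\colon\mathbf{Set}\to\mathcal V$ for the free algebra functor, left adjoint to $|{-}|$. A co-$\mathcal V$-algebra in $\mathcal V$ is a model of $T$ in $\mathcal V^{\mathrm{op}}$; these form the category $\mathcal V\mathcal V^c=(\text{models of }T\text{ in }\mathcal V^{\mathrm{op}})^{\mathrm{op}}$. A co-$\mathcal V$-algebra $C$ with underlying object $|C|\in\mathcal V$ represents a functor $\mathcal V(C,-)\colon\mathcal V\to\mathcal V$ which sends $A$ to the algebra with underlying set $\mathcal V(|C|,A)$ and operations induced by the co-operations of $C$. A functor $\mathcal V\to\mathcal V$ is called representable if it is isomorphic to some $\mathcal V(C,-)$. For a set $X$ let $\hat F(X)$ be $F(X)$ with the co-$\mathcal V$-algebra structure for which the adjunction bijection $\mathcal V(F(X),A)\cong\mathbf{Set}(X,|A|)$ is an isomorphism of algebras, natural in $A$, where $\mathbf{Set}(X,|A|)$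 has the pointwise operations. Then: 1. If $G,H\colon\mathcal V\to\mathcal V$ are representable, then so is $G\circ H$. 2. The identity functor of $\mathcal V$ is represented by $\hat F(\{*\})$: there is an isomorphism of functors $\mathcal V(\hat F(\{*\}),-)\cong\mathrm{Id}_{\mathcal V}$ whose underlying map of sets at $A$ is the adjunction bijection $\mathcal V(F(\{*\}),A)\cong\mathbf{Set}(\{*\},|A|)\cong|A|$. 3. Hence the full subcategory $\mathrm{CovRep}(\mathcal V,\mathcal V)$ of representable functors contains the unit of, and is closed under, the monoidal structure $(\circ,\mathrm{Id})$ of the category of all functors $\mathcal V\to\mathcal V$, and so inherits this structure. Moreover there is a monoidal structure $(\odot,I)$ on $\mathcal V\mathcal V^c$ such that the functor $(\mathcal V\mathcal V^c)^{\mathrm{op}}\to\mathrm{CovRep}(\mathcal V,\mathcal V)$, $C\mapsto\mathcal V(C,-)$, is an equivalence of monoidal categories (so that $\mathcal V(C_1\odot C_2,-)\cong\mathcal V(C_1,-)\circ\mathcal V(C_2,-)$), and $I\cong\hat F(\{*\})$ as co-$\mathcal V$-algebras. -/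

import Mathlib

open CategoryTheory Limits Opposite MonoidalCategory

universe u v w

namespace TallWraith

/-- A Lawvere theory: a (small) category with finite products in which every object is
isomorphic to a finite power of a distinguished object `gen`. -/
class LawvereTheory (T : Type u) [SmallCategory T] [HasFiniteProducts T] where
  /-- the distinguished object -/
  gen : T
  exists_iso_pow (t : T) : ∃ n : ℕ, Nonempty (t ≅ ∏ᶜ fun _ : Fin n => gen)

/-- The property of functors `T ⥤ D` of preserving finite products. -/
abbrev isModel (T : Type u) [SmallCategory T] (D : Type w) [Category.{v} D] :
    ObjectProperty (T ⥤ D) :=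
  fun F => PreservesFiniteProducts F

/-- The category of models of the theory `T` in `D`, i.e. of `T`-algebra objects in `D`:
finite-product-preserving functors `T ⥤ D` and natural transformations. -/
abbrev Model (T : Type u) [SmallCategory T] (D : Type w) [Category.{v} D] :=
  (isModel T D).FullSubcategory

/-- The variety of algebras of the theory `T`: its category of models in sets. -/
abbrev Variety (T : Type u) [SmallCategory T] := Model T (Type u)

/-- Co-algebra objects (of the theory `T`) in `D`: the opposite of the category of
`T`-algebra objects in `Dᵒᵖ`. -/
abbrev CoModel (T : Type u) [SmallCategory T] (D : Type w) [Category.{v} D] :=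
  (Model T Dᵒᵖ)ᵒᵖ

/-- Co-`V`-algebra objects in `V`, where `V` is the variety of algebras of `T`. -/
abbrev CoAlg (T : Type u) [SmallCategory T] := CoModel T (Variety T)

section

variable (T : Type u) [SmallCategory T]

/-- Evaluation of algebras at an object `t` of the theory. -/
abbrev evalAt (t : T) : Variety T ⥤ Type u :=
  (isModel T (Type u)).ι ⋙ (evaluation T (Type u)).obj t

/-- The natural transformation between evaluation functors given by an operation. -/
abbrev evalMap {s t : T} (f : s ⟶ t) : evalAt T s ⟶ evalAt T t :=
  Functor.whiskerLeft (isModel T (Type u)).ι ((evaluation T (Type u)).map f)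

/-- The underlying set of an algebra: its value at the distinguished object. -/
abbrev forgetful [HasFiniteProducts T] [LawvereTheory T] : Variety T ⥤ Type u :=
  evalAt T (LawvereTheory.gen (T := T))

instance isModel_closedUnderFilteredColimits (J : Type u) [SmallCategory J] [IsFiltered J] :
    (isModel T (Type u)).IsClosedUnderColimitsOfShape J where
  colimitsOfShape_le := by
    rintro G ⟨h⟩
    have := h.prop_diag_obj
    refine ⟨fun n => ?_⟩
    refine (ObjectProperty.preservesLimitsOfShape (Discrete (Fin n))).prop_of_isColimit
      h.isColimit (fun j => ?_)
    have : PreservesFiniteProducts (h.diag.obj j) := this j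
    exact PreservesFiniteProducts.preserves n

/-- The algebra `T(t, -)`. -/
def homAlg (t : T) : Variety T :=
  ⟨coyoneda.obj (op t), inferInstance⟩

lemma leftAdjointObjIsDefined_of_finite [HasFiniteProducts T] (t : T) (X : Type u) [Finite X] :
    (evalAt T t).leftAdjointObjIsDefined X := by
  have key (A : Variety T) (g : X → A.obj.obj t) :
      ∃! a : A.obj.obj (∏ᶜ fun _ : X => t), ∀ x, A.obj.map (Pi.π (fun _ : X => t) x) a = g x := by
    have : PreservesFiniteProducts A.obj := A.property
    have hl := isLimitOfPreserves A.obj (limit.isLimit (Discrete.functor fun _ : X => t))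
    obtain ⟨a, ha, hu⟩ := (Types.isLimit_iff _).1 ⟨hl⟩ (fun j => g j.as) (by
      rintro ⟨i⟩ ⟨j⟩ ⟨⟨h⟩⟩
      obtain rfl : i = j := h
      exact ConcreteCategory.congr_hom (A.obj.map_id t) (g i))
    exact ⟨a, fun x => ha ⟨x⟩, fun b hb => hu b fun j => hb j.as⟩
  have nat {A : Variety T} (φ : homAlg T (∏ᶜ fun _ : X => t) ⟶ A) {s : T}
      (f : (∏ᶜ fun _ : X => t) ⟶ s) :
      φ.hom.app s f = A.obj.map f (φ.hom.app _ (𝟙 (∏ᶜ fun _ : X => t))) := by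
    have h := ConcreteCategory.congr_hom (φ.hom.naturality f) (𝟙 (∏ᶜ fun _ : X => t))
    refine Eq.trans (congrArg (φ.hom.app s) ?_) h
    exact (Category.id_comp f).symm
  refine Functor.CorepresentableBy.isCorepresentable (X := homAlg T (∏ᶜ fun _ : X => t))
    { homEquiv := fun {A} => Equiv.ofBijective
        (fun φ => TypeCat.ofHom fun x => φ.hom.app t (Pi.π (fun _ : X => t) x)) ⟨?_, ?_⟩
      homEquiv_comp := fun _ _ => rfl }
  · intro φ ψ h
    have h' (x : X) : φ.hom.app t (Pi.π (fun _ : X => t) x) =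
        ψ.hom.app t (Pi.π (fun _ : X => t) x) := ConcreteCategory.congr_hom h x
    have e : φ.hom.app _ (𝟙 (∏ᶜ fun _ : X => t)) = ψ.hom.app _ (𝟙 (∏ᶜ fun _ : X => t)) :=
      (key A fun x => φ.hom.app t (Pi.π (fun _ : X => t) x)).unique
        (fun x => (nat φ _).symm) (fun x => ((h' x).trans (nat ψ _)).symm)
    apply ObjectProperty.hom_ext
    ext s f
    exact (nat φ f).trans ((congrArg _ e).trans (nat ψ f).symm)
  · intro g
    obtain ⟨a, ha, -⟩ := key A (fun x => (show X ⟶ A.obj.obj t from g) x)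
    refine ⟨⟨{ app := fun s => TypeCat.ofHom fun f => A.obj.map f a, naturality := ?_ }⟩, ?_⟩
    · intro s s' k
      ext f
      exact ConcreteCategory.congr_hom (A.obj.map_comp f k) a
    · change TypeCat.ofHom _ = (show X ⟶ A.obj.obj t from g)
      ext x
      exact ha x

/-- Evaluation functors on a variety, and in particular the forgetful functor to sets, have
left adjoints. -/
instance isRightAdjoint_evalAt [HasFiniteProducts T] (t : T) : (evalAt T t).IsRightAdjoint := by
  rw [Functor.isRightAdjoint_iff_leftAdjointObjIsDefined_eq_top]
  refine top_unique fun X _ => ?_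
  have := HasCardinalLT.Set.isFiltered_of_aleph0_le X Cardinal.aleph0 le_rfl
  refine Functor.leftAdjointObjIsDefined_of_isColimit
    (HasCardinalLT.Set.isColimitCocone X Cardinal.aleph0 le_rfl) fun j => ?_
  have : Finite ((HasCardinalLT.Set.functor X Cardinal.aleph0).obj j) :=
    (hasCardinalLT_aleph0_iff _).1 j.2
  exact leftAdjointObjIsDefined_of_finite T t _

/-- The left adjoint of the evaluation at `t`. -/
noncomputable abbrev freeAt [HasFiniteProducts T] (t : T) : Type u ⥤ Variety T :=
  (evalAt T t).leftAdjoint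

/-- The adjunction between `freeAt T t` and the evaluation at `t`. -/
noncomputable abbrev freeAdj [HasFiniteProducts T] (t : T) : freeAt T t ⊣ evalAt T t :=
  Adjunction.ofIsRightAdjoint (evalAt T t)

/-- The free algebra functor `F`, left adjoint to the forgetful functor. -/
noncomputable abbrev free [HasFiniteProducts T] [LawvereTheory T] : Type u ⥤ Variety T :=
  freeAt T (LawvereTheory.gen (T := T))

/-- The functor `t ↦ freeAt T t X` underlying the free co-algebra on `X`; on morphisms it is
given by taking mates, so that `V(freeAt T t X, A) ≅ Set(X, A(t))` is natural in `t`. -/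
noncomputable def freeCoalgFunctor [HasFiniteProducts T] (X : Type u) : T ⥤ (Variety T)ᵒᵖ where
  obj t := op ((freeAt T t).obj X)
  map {s t} f := (((conjugateEquiv (freeAdj T s) (freeAdj T t)).symm (evalMap T f)).app X).op
  map_id t := by
    have : evalMap T (𝟙 t) = 𝟙 _ := by
      simp [evalMap]
    rw [this, conjugateEquiv_symm_id]
    rfl
  map_comp {r s t} f g := by
    have : evalMap T (f ≫ g) = evalMap T f ≫ evalMap T g := by
      simp [evalMap]
    rw [this, ← conjugateEquiv_symm_comp (freeAdj T r) (freeAdj T s) (freeAdj T t)]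
    rfl

lemma freeAdj_homEquiv_mate [HasFiniteProducts T] (X : Type u) (A : Variety T) {s t : T}
    (f : s ⟶ t) (φ : (freeAt T s).obj X ⟶ A) :
    (freeAdj T t).homEquiv X A
        (((conjugateEquiv (freeAdj T s) (freeAdj T t)).symm (evalMap T f)).app X ≫ φ) =
      (freeAdj T s).homEquiv X A φ ≫ (evalMap T f).app A := by
  rw [Adjunction.homEquiv_unit, Adjunction.homEquiv_unit, Functor.map_comp, Category.assoc,
    (evalMap T f).naturality φ, ← Category.assoc, ← Category.assoc,
    unit_conjugateEquiv_symm]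

/-- `V(freeAt T t X, A) ≅ Set(X, A(t))`, naturally in `t`. -/
noncomputable def freeCoalgIso [HasFiniteProducts T] (X : Type u) (A : Variety T) :
    freeCoalgFunctor T X ⋙ yoneda.obj A ≅ A.obj ⋙ coyoneda.obj (op X) :=
  NatIso.ofComponents (fun t => ((freeAdj T t).homEquiv X A).toIso) (by
    intro s t f
    ext φ
    exact freeAdj_homEquiv_mate T X A f φ)

instance [HasFiniteProducts T] (X : Type u) : PreservesFiniteProducts (freeCoalgFunctor T X) where
  preserves n := ⟨fun {K} => ⟨fun {c} hc => ⟨yonedaJointlyReflectsLimits _ _ fun A => by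
    have : PreservesFiniteProducts A.obj := A.property
    have : PreservesLimit K (freeCoalgFunctor T X ⋙ yoneda.obj A) :=
      preservesLimit_of_natIso K (freeCoalgIso T X A).symm
    exact isLimitOfPreserves (freeCoalgFunctor T X ⋙ yoneda.obj A) hc⟩⟩⟩

/-- The lift of the free algebra functor to co-algebras, on objects: the free algebra on a set
`X`, with the co-algebra structure for which `V(F(X), A) ≅ Set(X, A)` is an isomorphism of
algebras, where `Set(X, A)` is an algebra pointwise. -/
noncomputable def freeCoalg [HasFiniteProducts T] (X : Type u) : CoAlg T :=
  op ⟨freeCoalgFunctor T X, inferInstance⟩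

/-- The functor `V ⥤ V` represented by a co-algebra `C`: it sends `A` to the set of morphisms
from the underlying object of `C` to `A`, with the algebra structure induced from the
co-algebra structure of `C`. -/
@[simps]
def homFunctor (C : CoAlg T) : Variety T ⥤ Variety T where
  obj A := ⟨C.unop.obj ⋙ yoneda.obj A, by
    have : PreservesFiniteProducts C.unop.obj := C.unop.property
    exact comp_preservesFiniteProducts _ _⟩
  map f := ObjectProperty.homMk (Functor.whiskerLeft C.unop.obj (yoneda.map f))

/-- The contravariant dependence of the represented functor on the co-algebra. -/
@[simps]
def homFunctorMap {C D : CoAlg T} (f : D ⟶ C) : homFunctor T C ⟶ homFunctor T D where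
  app A := ObjectProperty.homMk (Functor.whiskerRight f.unop.hom (yoneda.obj A))

/-- The category of endofunctors of the variety, with the monoidal structure given by
composition: `G ⊗ H` is `G ∘ H`, i.e. `A ↦ G (H A)`. (In Mathlib, `endofunctorMonoidalCategory`
has the tensor product in the reverse order, whence the monoidal opposite.) -/
abbrev CovFun := (Variety T ⥤ Variety T)ᴹᵒᵖ

instance : MonoidalCategory (CovFun T) :=
  letI := endofunctorMonoidalCategory (Variety T)
  monoidalCategoryMop

/-- A functor `V ⥤ V` is representable if it is isomorphic to the functor represented by a
co-algebra. -/
def IsRepresentable (G : Variety T ⥤ Variety T) : Prop :=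
  ∃ C : CoAlg T, Nonempty (homFunctor T C ≅ G)

/-- Representability as a property of objects of `CovFun T`. -/
def isRep : ObjectProperty (CovFun T) := fun G => IsRepresentable T G.unmop

/-- The full subcategory of representable endofunctors. -/
abbrev CovRep := (isRep T).FullSubcategory

/-- The functor `C ↦ V(C, -)` from the opposite of co-algebras to representable functors. -/
def toCovRep : (CoAlg T)ᵒᵖ ⥤ CovRep T where
  obj C := ⟨.mop (homFunctor T C.unop), C.unop, ⟨Iso.refl _⟩⟩
  map f := ObjectProperty.homMk (homFunctorMap T f.unop).mop

end

end TallWraith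

universe u₁ u₂ v₁ v₂

namespace TallWraith

/-! The key point is that every `V(D, -)` has a left adjoint `L`. It preserves coproducts, so
applying it to a co-algebra `C` gives a co-algebra again, and `V(L|C|, A) ≅ V(|C|, V(D, A))` shows
that this co-algebra represents `V(C, -) ∘ V(D, -)`. The adjoint exists because the variety is
cocomplete: its algebras are the functors local for a small set of maps between finitely presentable
ones, hence reflective among all functors on `T`. The identity is represented by the free algebra on
a point. By Yoneda `C ↦ V(C, -)` is fully faithful, hence an equivalence onto the representable
functors, and composition is transported along it to give `⊙`. -/

/-- The inverse of an equivalence is monoidal for the transported structure. -/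
@[reducible]
def monoidalInverse {C : Type u₁} [Category.{v₁} C] [MonoidalCategory C] {D : Type u₂}
    [Category.{v₂} D] (e : C ≌ D) :
    letI := Monoidal.transport e
    e.inverse.Monoidal :=
  inferInstanceAs (Monoidal.equivalenceTransported e).inverse.Monoidal

section

variable (T : Type u) [SmallCategory T]

/-! ### Cocompleteness of the variety -/

/-- The comparison morphism `∐ T(tᵢ, -) ⟶ T(∏ tᵢ, -)`. -/
noncomputable abbrev prodComparisonHom [HasFiniteProducts T] (p : Σ n : ℕ, Fin n → T) :
    (∐ fun i => coyoneda.obj (op (p.2 i))) ⟶ coyoneda.obj (op (∏ᶜ p.2)) :=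
  Sigma.desc fun i => coyoneda.map (Pi.π p.2 i).op

/-- The morphisms of functors with respect to which models are the local objects. -/
abbrev prodComparisons [HasFiniteProducts T] : MorphismProperty (T ⥤ Type u) :=
  .ofHoms (prodComparisonHom T)

lemma preservesLimit_iff_bijective [HasFiniteProducts T] (A : T ⥤ Type u) {n : ℕ}
    (t : Fin n → T) :
    PreservesLimit (Discrete.functor t) A ↔
      Function.Bijective fun (a : A.obj (∏ᶜ t)) i => A.map (Pi.π t i) a := by
  have h : PreservesLimit (Discrete.functor t) A ↔
      Nonempty (IsLimit (A.mapCone (limit.cone (Discrete.functor t)))) :=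
    ⟨fun _ => ⟨isLimitOfPreserves A (limit.isLimit _)⟩,
      fun ⟨h⟩ => preservesLimit_of_preserves_limit_cone (limit.isLimit _) h⟩
  rw [h, Types.isLimit_iff, Function.bijective_iff_existsUnique]
  constructor
  · intro h g
    obtain ⟨a, ha, hu⟩ := h (fun j => g j.as) (by
      rintro ⟨i⟩ ⟨j⟩ ⟨⟨h⟩⟩
      obtain rfl : i = j := h
      exact ConcreteCategory.congr_hom (A.map_id (t i)) (g i))
    exact ⟨a, funext fun i => ha ⟨i⟩, fun b hb => hu b fun j => congrFun hb j.as⟩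
  · intro h s _
    obtain ⟨a, ha, hu⟩ := h fun i => s ⟨i⟩
    exact ⟨a, fun j => congrFun ha j.as, fun b hb => hu b (funext fun i => hb ⟨i⟩)⟩

/-- By Yoneda, a map from the coproduct to `A` is a family of elements of the `A(tᵢ)`, so
precomposition with the comparison becomes `A(∏ tᵢ) → ∏ A(tᵢ)`. -/
lemma bijective_prodComparisonHom_comp_iff [HasFiniteProducts T] (A : T ⥤ Type u) {n : ℕ}
    (t : Fin n → T) :
    Function.Bijective (fun φ : coyoneda.obj (op (∏ᶜ t)) ⟶ A => prodComparisonHom T ⟨n, t⟩ ≫ φ) ↔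
      Function.Bijective fun (a : A.obj (∏ᶜ t)) i => A.map (Pi.π t i) a := by
  let e : ((∐ fun i => coyoneda.obj (op (t i))) ⟶ A) ≃ ∀ i, A.obj (t i) :=
    { toFun φ i := coyonedaEquiv (Sigma.ι (fun i => coyoneda.obj (op (t i))) i ≫ φ)
      invFun a := Sigma.desc fun i => coyonedaEquiv.symm (a i)
      left_inv φ := by
        refine Sigma.hom_ext _ _ fun i => ?_
        dsimp only
        rw [Sigma.ι_desc, Equiv.symm_apply_apply]
      right_inv a := by
        ext i
        dsimp only
        rw [Sigma.ι_desc, Equiv.apply_symm_apply] }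
  rw [← e.bijective.of_comp_iff', ← Function.Bijective.of_comp_iff _ coyonedaEquiv.bijective]
  convert Iff.rfl using 2
  ext φ i
  change A.map (Pi.π t i) (coyonedaEquiv φ) = coyonedaEquiv
    (Sigma.ι (fun i => coyoneda.obj (op (t i))) i ≫ Sigma.desc _ ≫ φ)
  rw [Sigma.ι_desc_assoc, coyonedaEquiv_naturality]

lemma isModel_eq_isLocal [HasFiniteProducts T] :
    isModel T (Type u) = (prodComparisons T).isLocal := by
  ext A
  constructor
  · rintro h _ _ _ ⟨n, t⟩
    have : PreservesFiniteProducts A := h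
    exact (bijective_prodComparisonHom_comp_iff T A t).2
      ((preservesLimit_iff_bijective T A t).1 inferInstance)
  · refine fun h => ⟨fun n => ⟨fun {K} => ?_⟩⟩
    have : PreservesLimit (Discrete.functor (K.obj ∘ Discrete.mk)) A :=
      (preservesLimit_iff_bijective T A _).2
        ((bijective_prodComparisonHom_comp_iff T A _).1
          (h _ (.mk (f := prodComparisonHom T) ⟨n, K.obj ∘ Discrete.mk⟩)))
    exact preservesLimit_of_iso_diagram A Discrete.natIsoFunctor.symm

/-- Maps out of `T(t, -)` are evaluation at `t`, which preserves all colimits. -/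
instance isCardinalPresentable_coyoneda (κ : Cardinal.{u}) [Fact κ.IsRegular] (t : T) :
    IsCardinalPresentable (coyoneda.obj (op t)) κ where
  preservesColimitOfShape J _ _ :=
    preservesColimitsOfShape_of_natIso
      (NatIso.ofComponents
        (fun P => (coyonedaEquiv (X := t) (F := P)).symm.toIso) (by
          intro P Q f
          ext x
          apply coyonedaEquiv.injective
          exact (Equiv.apply_symm_apply _ _).trans (by
            change _ = coyonedaEquiv
              ((coyonedaEquiv (X := t) (F := P)).symm x ≫ (show P ⟶ Q from f))
            rw [coyonedaEquiv_comp, Equiv.apply_symm_apply]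
            rfl)) :
        (evaluation T (Type u)).obj t ≅ coyoneda.obj (op (coyoneda.obj (op t))))

instance isRightAdjoint_ι [HasFiniteProducts T] : (isModel T (Type u)).ι.IsRightAdjoint := by
  rw [isModel_eq_isLocal]
  have : Fact Cardinal.aleph0.{u}.IsRegular := ⟨Cardinal.isRegular_aleph0⟩
  refine MorphismProperty.isRightAdjoint_ι_isLocal _ Cardinal.aleph0.{u} ?_
  rintro _ _ _ ⟨p⟩
  have (k : Discrete (Fin p.1)) : IsCardinalPresentable
      ((Discrete.functor fun i => coyoneda.obj (op (p.2 i))).obj k) Cardinal.aleph0.{u} :=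
    isCardinalPresentable_coyoneda T _ (p.2 k.as)
  -- The source is a finite coproduct of finitely presentable objects.
  exact ⟨isCardinalPresentable_of_isColimit' _ (coproductIsCoproduct _) _
    (hasCardinalLT_of_finite _ _ le_rfl), inferInstance⟩

noncomputable instance [HasFiniteProducts T] : Reflective (isModel T (Type u)).ι where
  L := _
  adj := Adjunction.ofIsRightAdjoint _

instance [HasFiniteProducts T] : HasColimitsOfSize.{u, u} (Variety T) :=
  hasColimits_of_reflective (isModel T (Type u)).ι

/-! ### Left adjoints and composition of represented functors -/

/-- The functor represented by a co-algebra, followed by the inclusion. -/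
def homFunctorCompιIso (C : CoAlg T) :
    homFunctor T C ⋙ (isModel T (Type u)).ι ≅
      Presheaf.restrictedULiftYoneda.{u} C.unop.obj.leftOp ⋙
        (Functor.whiskeringLeft _ _ _).obj (opOp T) :=
  NatIso.ofComponents (fun A => NatIso.ofComponents (fun t => Equiv.ulift.symm.toIso))

instance isRightAdjoint_homFunctor [HasFiniteProducts T] (C : CoAlg T) :
    (homFunctor T C).IsRightAdjoint := by
  -- The adjoint is the left Kan extension of `C` along Yoneda, available by cocompleteness.
  have : (Presheaf.restrictedULiftYoneda.{u} C.unop.obj.leftOp).IsRightAdjoint :=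
    (Presheaf.uliftYonedaAdjunction.{u} (uliftYoneda.{u}.leftKanExtension C.unop.obj.leftOp)
      (uliftYoneda.{u}.leftKanExtensionUnit C.unop.obj.leftOp)).isRightAdjoint
  have : (homFunctor T C ⋙ (isModel T (Type u)).ι).IsRightAdjoint :=
    Functor.isRightAdjoint_of_iso (homFunctorCompιIso T C).symm
  -- Models form a full subcategory, so the adjoint on all functors restricts to them.
  exact (Adjunction.restrictFullyFaithful (iC := (isModel T (Type u)).ι) (iD := 𝟭 _)
    (L := (isModel T (Type u)).ι ⋙ (homFunctor T C ⋙ (isModel T (Type u)).ι).leftAdjoint)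
    (Adjunction.ofIsRightAdjoint (homFunctor T C ⋙ (isModel T (Type u)).ι))
    (isModel T (Type u)).fullyFaithfulι (Functor.FullyFaithful.id _)
    (Iso.refl _) (Iso.refl _)).isRightAdjoint

/-- The co-algebra representing the composite of two representable functors. -/
noncomputable def compCoalg [HasFiniteProducts T] (C D : CoAlg T) : CoAlg T :=
  op ⟨C.unop.obj ⋙ (homFunctor T D).leftAdjoint.op, by
    have : PreservesFiniteProducts C.unop.obj := C.unop.property
    have : (homFunctor T D).leftAdjoint.op.IsRightAdjoint :=
      (Adjunction.ofIsRightAdjoint (homFunctor T D)).op.isRightAdjoint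
    exact comp_preservesFiniteProducts _ _⟩

/-- `V(C ⊙ D, -) ≅ V(C, -) ∘ V(D, -)`. -/
noncomputable def homFunctorCompCoalgIso [HasFiniteProducts T] (C D : CoAlg T) :
    homFunctor T (compCoalg T C D) ≅ homFunctor T D ⋙ homFunctor T C :=
  NatIso.ofComponents (fun A => ObjectProperty.isoMk _ (NatIso.ofComponents (fun t =>
    ((Adjunction.ofIsRightAdjoint (homFunctor T D)).homEquiv (C.unop.obj.obj t).unop A).toIso)
    (by
      intro s t f
      ext φ
      exact Adjunction.homEquiv_naturality_left _ _ _)))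
    (by
      intro A B f
      ext t φ
      exact Adjunction.homEquiv_naturality_right _ _ _)

lemma IsRepresentable.comp [HasFiniteProducts T] {G H : Variety T ⥤ Variety T}
    (hG : IsRepresentable T G) (hH : IsRepresentable T H) : IsRepresentable T (H ⋙ G) := by
  obtain ⟨C, ⟨e⟩⟩ := hG
  obtain ⟨D, ⟨e'⟩⟩ := hH
  exact ⟨compCoalg T C D, ⟨homFunctorCompCoalgIso T C D ≪≫
    Functor.isoWhiskerRight e' _ ≪≫ Functor.isoWhiskerLeft H e⟩⟩

/-- The identity functor is represented by the free co-algebra on a point. -/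
noncomputable def homFunctorFreeCoalgIso [HasFiniteProducts T] :
    homFunctor T (freeCoalg T PUnit.{u + 1}) ≅ 𝟭 (Variety T) :=
  NatIso.ofComponents (fun A => ObjectProperty.isoMk _
    (freeCoalgIso T PUnit A ≪≫ Functor.isoWhiskerLeft A.obj Coyoneda.punitIso))
    (by
      intro A B f
      ext t φ
      exact ConcreteCategory.congr_hom
        (Adjunction.homEquiv_naturality_right (freeAdj T t) φ f) PUnit.unit)

/-! ### Full faithfulness by Yoneda -/

lemma homFunctor_hom_app_apply {C D : CoAlg T} (α : homFunctor T C ⟶ homFunctor T D)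
    {A : Variety T} {t : T} (φ : (C.unop.obj.obj t).unop ⟶ A) :
    (show (D.unop.obj.obj t).unop ⟶ A from (α.app A).hom.app t φ) =
      (show (D.unop.obj.obj t).unop ⟶ (C.unop.obj.obj t).unop from
        (α.app (C.unop.obj.obj t).unop).hom.app t (𝟙 (C.unop.obj.obj t).unop)) ≫ φ := by
  -- Naturality of `α` along `φ`, to be evaluated at the identity.
  have h : ((homFunctor T C).map φ).hom.app t ≫ (α.app A).hom.app t =
      (α.app _).hom.app t ≫ ((homFunctor T D).map φ).hom.app t :=
    congrArg (fun β => β.hom.app t) (α.naturality φ)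
  have h := ConcreteCategory.congr_hom h
    (show ((homFunctor T C).obj (C.unop.obj.obj t).unop).obj.obj t from
      𝟙 (C.unop.obj.obj t).unop)
  exact (congrArg ((α.app A).hom.app t) (Category.id_comp φ).symm).trans h

/-- Yoneda: morphisms of represented functors come from morphisms of co-algebras. -/
def homFunctorPreimage {C D : CoAlg T} (α : homFunctor T C ⟶ homFunctor T D) : D ⟶ C :=
  Quiver.Hom.op (ObjectProperty.homMk
    { app t := Quiver.Hom.op (show (D.unop.obj.obj t).unop ⟶ (C.unop.obj.obj t).unop from
        (α.app (C.unop.obj.obj t).unop).hom.app t (𝟙 (C.unop.obj.obj t).unop))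
      naturality s t f := by
        apply Quiver.Hom.unop_inj
        -- Both sides equal `α` applied to the co-operation of `C`: one by the Yoneda formula, the
        -- other because the components of `α` are algebra homomorphisms.
        refine (homFunctor_hom_app_apply T α (C.unop.obj.map f).unop).symm.trans ?_
        have h := ConcreteCategory.congr_hom
          ((α.app (C.unop.obj.obj s).unop).hom.naturality f) (𝟙 (C.unop.obj.obj s).unop)
        exact (congrArg ((α.app _).hom.app t)
          (Category.comp_id (C.unop.obj.map f).unop).symm).trans h })

lemma homFunctorMap_homFunctorPreimage {C D : CoAlg T} (α : homFunctor T C ⟶ homFunctor T D) :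
    homFunctorMap T (homFunctorPreimage T α) = α := by
  refine NatTrans.ext (funext fun A => ObjectProperty.hom_ext _ (NatTrans.ext (funext fun t =>
    ConcreteCategory.hom_ext (C := Type u) _ _ fun φ => ?_)))
  exact (homFunctor_hom_app_apply T α φ).symm

lemma homFunctorMap_injective {C D : CoAlg T} :
    Function.Injective (homFunctorMap T : (D ⟶ C) → _) := by
  intro f g h
  apply Quiver.Hom.unop_inj
  apply ObjectProperty.hom_ext
  ext t
  apply Quiver.Hom.unop_inj
  have h' : ((homFunctorMap T f).app (C.unop.obj.obj t).unop).hom.app t =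
      ((homFunctorMap T g).app (C.unop.obj.obj t).unop).hom.app t := by rw [h]
  have h' := ConcreteCategory.congr_hom h'
    (show ((homFunctor T C).obj (C.unop.obj.obj t).unop).obj.obj t from
      𝟙 (C.unop.obj.obj t).unop)
  have h' : (f.unop.hom.app t).unop ≫ 𝟙 (C.unop.obj.obj t).unop =
      (g.unop.hom.app t).unop ≫ 𝟙 (C.unop.obj.obj t).unop := h'
  simpa only [Category.comp_id] using h'

instance : (toCovRep T).Faithful where
  map_injective h := Quiver.Hom.unop_inj
    (homFunctorMap_injective T (congrArg (fun β => β.hom.unmop) h))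

instance : (toCovRep T).Full where
  map_surjective α := ⟨(homFunctorPreimage T α.hom.unmop).op,
    ObjectProperty.hom_ext _ (congrArg Quiver.Hom.mop
      (homFunctorMap_homFunctorPreimage T α.hom.unmop))⟩

instance : (toCovRep T).EssSurj where
  mem_essImage G := by
    obtain ⟨C, ⟨e⟩⟩ := G.property
    exact ⟨op C, ⟨ObjectProperty.isoMk _ e.mop⟩⟩

instance : (toCovRep T).IsEquivalence where

instance [HasFiniteProducts T] : (isRep T).IsMonoidal where
  prop_unit := ⟨freeCoalg T PUnit, ⟨homFunctorFreeCoalgIso T⟩⟩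
  prop_tensor _ _ hG hH := hG.comp T hH

/-! ### Transport of the monoidal structure -/

/-- Representable functors are equivalent to algebras in the opposite of the variety. -/
noncomputable def modelEquiv : CovRep T ≌ Model T (Variety T)ᵒᵖ :=
  -- `(CoAlg T)ᵒᵖ` is a double opposite of the category of models; the structure is put on models
  -- first and then passed to their opposite.
  (opOp _ ⋙ toCovRep T).asEquivalence.symm

/-- The isomorphism of `toCovRep T` with the inverse of `modelEquiv T`. -/
noncomputable def unopUnopCompModelEquivInverseIso :
    unopUnop _ ⋙ (modelEquiv T).inverse ≅ toCovRep T :=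
  Iso.refl (toCovRep T)

/-- The monoidal structure `⊙` on co-algebras, transported from the composition of
representable functors. -/
@[reducible]
noncomputable def monoidalCoAlg [HasFiniteProducts T] : MonoidalCategory (CoAlg T) :=
  letI := Monoidal.transport (modelEquiv T)
  monoidalCategoryOp

/-- The functor `C ↦ V(C, -)` is monoidal. -/
@[reducible]
noncomputable def monoidalToCovRep [HasFiniteProducts T] :
    letI := monoidalCoAlg T
    (toCovRep T).Monoidal :=
  letI := Monoidal.transport (modelEquiv T)
  letI := monoidalInverse (modelEquiv T)
  Functor.Monoidal.transport (unopUnopCompModelEquivInverseIso T)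

end

end TallWraith

theorem mainTheorem4 (T : Type u) [SmallCategory T] [HasFiniteProducts T]
    [TallWraith.LawvereTheory T] :
    (∀ G H : TallWraith.Variety T ⥤ TallWraith.Variety T,
      TallWraith.IsRepresentable T G → TallWraith.IsRepresentable T H →
        TallWraith.IsRepresentable T (H ⋙ G)) ∧
    (∃ e : TallWraith.homFunctor T (TallWraith.freeCoalg T PUnit) ≅ 𝟭 (TallWraith.Variety T),
      ∀ (A : TallWraith.Variety T) (f : (TallWraith.free T).obj PUnit ⟶ A),
        (e.hom.app A).hom.app (TallWraith.LawvereTheory.gen (T := T)) f =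
          (TallWraith.freeAdj T (TallWraith.LawvereTheory.gen (T := T))).homEquiv PUnit A f
            PUnit.unit) ∧
    ∃ (_ : (TallWraith.isRep T).IsMonoidal) (_ : MonoidalCategory (TallWraith.CoAlg T))
      (_ : (TallWraith.toCovRep T).Monoidal),
      (TallWraith.toCovRep T).IsEquivalence ∧
      Nonempty (𝟙_ (TallWraith.CoAlg T) ≅ TallWraith.freeCoalg T PUnit) := by
  refine ⟨fun _ _ hG hH => hG.comp T hH, ⟨TallWraith.homFunctorFreeCoalgIso T, fun A f => rfl⟩,
    inferInstance, TallWraith.monoidalCoAlg T, TallWraith.monoidalToCovRep T, inferInstance, ?_⟩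
  let _ := TallWraith.monoidalCoAlg T
  let _ := TallWraith.monoidalToCovRep T
  -- Both co-algebras represent the identity functor, and a fully faithful functor reflects
  -- isomorphisms between objects; `unop` undoes its contravariance.
  let e : (TallWraith.toCovRep T).obj (op (TallWraith.freeCoalg T PUnit)) ≅
      𝟙_ (TallWraith.CovRep T) :=
    ObjectProperty.isoMk _ (TallWraith.homFunctorFreeCoalgIso T).mop
  exact ⟨((TallWraith.toCovRep T).preimageIso
    (e ≪≫ Functor.Monoidal.εIso (TallWraith.toCovRep T))).unop⟩
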